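/- **Setting.** Fix a finite field $GF(q)$ and an integer $g\ge 1$. A file of $N=ng$ information packets is partitioned into $n$ disjoint generations of size $g$. Each collected coded packet belongs to a generation chosen uniformly at random among the $n$ generations, and is a linear combination of the $g$ packets of that generation with coefficients chosen independently and uniformly from $GF(q)$; different coded packets are independent. The file is decoded as soon as, for every generation, $g$ packets of that generation with linearly independent coding vectors have been collected. Let $W_n(g)$ be the number of coded packets collected until then, so that the probability of decoding failure after $t$ collected packets is $\Pr[W_n(g)>t]$. Let $T_n(g)$ be the number of independent uniform draws with replacement from $n$ coupons needed to obtain at least $g$ copies of every coupon. Logarithms are natural. **Statement.** $E[T_n(g)]<\infty$ for all $n\ge 1$, and the following hold. 1. For every $\delta_0<1$ there is $n_0$ (depending on $q,g,\delta_0$) such that for all $n\ge n_0$ and all $0<\delta\le\delta_0$: if the probability of decoding failure after $t$ collected coded packets is smaller than $\delta$, i.e. $\Pr[W_n(g)>t]<\delta$, then $$t\ \ge\ E[T_n(g)]-n\log\log\frac{1}{1-\delta}.$$ 2. For every constant $c>0$ there is $n_0$ (depending on $q,g,c$) such that for all $n\ge n_0$: if $\Pr[W_n(g)>t]<\delta=\frac{1}{N^{c}}=\frac1{(ng)^{c}}$,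 then $$t\ \ge\ E[T_n(g)]+c\,n\log(ng).$$ -/

import Mathlib

open MeasureTheory

namespace GenerationCoding

noncomputable section

/-! ### Collecting `m` copies of each of `n` coupons -/

/-- Infinitely many independent uniform draws, with replacement, from `n` coupons. -/
def couponLaw (n : ℕ) [NeZero n] : Measure (ℕ → Fin n) :=
  Measure.infinitePi fun _ : ℕ => (PMF.uniformOfFintype (Fin n)).toMeasure

/-- Number of copies of the coupon `i` among the first `t` draws of `x`. -/
def copies {n : ℕ} (x : ℕ → Fin n) (t : ℕ) (i : Fin n) : ℕ :=
  ((Finset.range t).filter fun k => x k = i).card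

/-- `T_n(m)`: the number of draws needed until at least `m` copies of every coupon have been
collected (`⊤` if this never happens). -/
def collectionTime {n : ℕ} (m : ℕ) (x : ℕ → Fin n) : ℕ∞ :=
  sInf ((fun t : ℕ => (t : ℕ∞)) '' {t : ℕ | ∀ i : Fin n, m ≤ copies x t i})

/-- `E[T_n(m)]`, as an extended nonnegative number. -/
def expectedCollectionTime (n m : ℕ) [NeZero n] : ENNReal :=
  ∫⁻ x, (collectionTime m x : ENNReal) ∂(couponLaw n)

/-! ### Random linear coding over `n` disjoint generations of size `g` -/

/-- The header of a coded packet: the index of a generation together with the coding vector, i.e.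
the coefficients of the linear combination of the `g` information packets of that generation. -/
def CodedPacket (F : Type*) (n g : ℕ) : Type _ := Fin n × (Fin g → F)

/-- The generation from which the packet was formed. -/
def CodedPacket.generation {F : Type*} {n g : ℕ} (p : CodedPacket F n g) : Fin n := p.1

/-- The coding vector of the packet. -/
def CodedPacket.vector {F : Type*} {n g : ℕ} (p : CodedPacket F n g) : Fin g → F := p.2

instance (F : Type*) (n g : ℕ) [Fintype F] : Fintype (CodedPacket F n g) :=
  inferInstanceAs (Fintype (Fin n × (Fin g → F)))

instance (F : Type*) (n g : ℕ) [Nonempty F] [NeZero n] : Nonempty (CodedPacket F n g) :=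
  inferInstanceAs (Nonempty (Fin n × (Fin g → F)))

/-- Every set of packets is an event. -/
instance (F : Type*) (n g : ℕ) : MeasurableSpace (CodedPacket F n g) := ⊤

/-- The law of the sequence of collected coded packets: the packets are independent; for each of
them the generation is uniform among the `n` generations and, independently, the `g` coefficients
are independent and uniform in `F`. -/
def packetLaw (F : Type*) [Field F] [Fintype F] (n g : ℕ) [NeZero n] :
    Measure (ℕ → CodedPacket F n g) :=
  Measure.infinitePi fun _ : ℕ => (PMF.uniformOfFintype (CodedPacket F n g)).toMeasure

/-- The generation `j` is decodable from the first `t` packets: among them there are `g` packets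
of this generation with linearly independent coding vectors. -/
def Decodable {F : Type*} [Field F] {n g : ℕ} (ω : ℕ → CodedPacket F n g) (t : ℕ) (j : Fin n) :
    Prop :=
  ∃ k : Fin g → ℕ, (∀ i, k i < t ∧ (ω (k i)).generation = j) ∧
    LinearIndependent F fun i => (ω (k i)).vector

/-- `W_n(g)`: the number of coded packets collected until all generations, hence all `n * g`
information packets, are decoded (`⊤` if this never happens). -/
def decodingLatency {F : Type*} [Field F] {n g : ℕ} (ω : ℕ → CodedPacket F n g) : ℕ∞ :=
  sInf ((fun t : ℕ => (t : ℕ∞)) '' {t : ℕ | ∀ j : Fin n, Decodable ω t j})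

/-- The probability of decoding failure, `Prob[W_n(g) > t]`, when `t` coded packets have been
collected. -/
def failureProb (F : Type*) [Field F] [Fintype F] (n g : ℕ) [NeZero n] (t : ℕ) : ℝ :=
  (packetLaw F n g).real {ω | (t : ℕ∞) < decodingLatency ω}

end

end GenerationCoding

/-!
For a fixed finite field with `q` elements, random coding wastes a constant fraction of the packets,
and this dominates every lower-order term of `E[T_n(g)]`.

*Failure.* Fix one coordinate. A generation cannot be decoded before a packet of that generation
with a nonzero coefficient there has arrived, and a packet is of this kind with probability `a / n`,
`a = 1 - 1 / q < 1`. The expected number of generations still waiting for such a packet after `t`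
draws is `s = n (1 - a / n) ^ t`, about `n exp (-a t / n)`. The waiting events are negatively
correlated in pairs, so the second moment method bounds the failure probability below by
`s / (1 + s)` (`div_one_add_le_failureProb`).

*Collection.* Summing the Chernoff bound for the number of copies of one coupon over all coupons
gives, for each `y < 1`, `E[T_n(g)] ≤ n log n / y + C n` with `C` depending on `y` and `g` only
(`expectedCollectionTime_le`, where `y = 1 - z`). In particular the expectation is finite.

*Comparison.* Choose `a < y < 1`. If `t < E[T_n(g)] - n log l`, then `s` is at least of order
`n ^ (1 - b / y) l ^ b` for some `b ∈ (a, y)`. Because `b < 1` and `l` is bounded, this exceeds any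
fixed multiple of `l` once `n` is large, uniformly in `l` (`exists_forall_mul_le_mul_pow`). Hence
the failure probability is at least `δ` whenever `δ ≤ l` and `δ` stays away from `1`
(`exists_forall_sub_mul_log_le`). The two claims are the cases `l = log (1 / (1 - δ)) ≥ δ` and
`l = δ = (n g) ^ (-c)`.
-/

namespace GenerationCoding

/-! ### The expected collection time -/

/-- Tail sum bound for extended natural numbers, with the first `t₀` tail terms replaced by `1`. -/
lemma toENNReal_le_add_tsum_indicator (m : ℕ∞) (t₀ : ℕ) :
    (m : ENNReal) ≤ t₀ + ∑' s : ℕ, if ((t₀ + s : ℕ) : ℕ∞) < m then 1 else 0 := by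
  induction m using ENat.recTopCoe with
  | top =>
    simp only [ENat.natCast_lt_top, if_true]
    rw [ENNReal.tsum_const_eq_top_of_ne_zero one_ne_zero]
    simp
  | coe k =>
    calc ((k : ℕ∞) : ENNReal) ≤ ((t₀ + (k - t₀) : ℕ) : ENNReal) := by
          rw [ENat.toENNReal_coe]; exact_mod_cast (by omega)
      _ = t₀ + ∑ s ∈ Finset.range (k - t₀),
            if ((t₀ + s : ℕ) : ℕ∞) < (k : ℕ∞) then (1 : ENNReal) else 0 := by
          rw [Finset.sum_congr rfl (g := fun _ => (1 : ENNReal))]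
          · simp
          · intro s hs
            rw [Finset.mem_range] at hs
            rw [if_pos (by exact_mod_cast (by omega))]
      _ ≤ _ := by gcongr; exact ENNReal.sum_le_tsum _

lemma pow_copies_eq_prod {n : ℕ} (x : ℕ → Fin n) (t : ℕ) (i : Fin n) (w : ENNReal) :
    w ^ copies x t i = ∏ k ∈ Finset.range t, if x k = i then w else 1 := by
  simp [copies, Finset.prod_ite]

lemma lintegral_uniform_ite (n : ℕ) [NeZero n] (i : Fin n) {z : ℝ} (hz : 0 ≤ z) :
    ∫⁻ a, (if a = i then ENNReal.ofReal z else 1) ∂(PMF.uniformOfFintype (Fin n)).toMeasure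
      = ENNReal.ofReal (1 - (1 - z) / n) := by
  have hn : (0 : ℝ) < n := by exact_mod_cast Nat.pos_of_ne_zero (NeZero.ne n)
  have h (a : Fin n) : (if a = i then ENNReal.ofReal z else 1) *
      (PMF.uniformOfFintype (Fin n)).toMeasure {a}
      = ENNReal.ofReal ((if a = i then z else 1) * (n : ℝ)⁻¹) := by
    rw [PMF.toMeasure_apply_singleton _ _ (measurableSet_singleton a),
      PMF.uniformOfFintype_apply, Fintype.card_fin, ENNReal.ofReal_mul (by split_ifs <;> simp [hz]),
      ENNReal.ofReal_inv_of_pos hn, ENNReal.ofReal_natCast]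
    split_ifs <;> simp
  have hite (a : Fin n) : (if a = i then z else 1) = 1 + if a = i then z - 1 else 0 := by
    split_ifs <;> ring
  rw [lintegral_fintype, Finset.sum_congr rfl fun a _ => h a,
    ← ENNReal.ofReal_sum_of_nonneg fun a _ => by split_ifs <;> positivity, ← Finset.sum_mul]
  congr 1
  simp only [hite, Finset.sum_add_distrib]
  simp
  field_simp
  ring

/-- The probability generating function of the number of copies of a coupon, a binomial variable. -/
lemma lintegral_pow_copies (n : ℕ) [NeZero n] (t : ℕ) (i : Fin n) {z : ℝ} (hz : 0 ≤ z) :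
    ∫⁻ x, ENNReal.ofReal z ^ copies x t i ∂(couponLaw n)
      = ENNReal.ofReal (1 - (1 - z) / n) ^ t := by
  have hf : Measurable fun a : Fin n => if a = i then ENNReal.ofReal z else (1 : ENNReal) :=
    measurable_of_countable _
  have hind := ProbabilityTheory.iIndepFun_infinitePi (ι := ℕ)
    (P := fun _ => (PMF.uniformOfFintype (Fin n)).toMeasure)
    (X := fun _ a => if a = i then ENNReal.ofReal z else (1 : ENNReal)) (fun _ => hf)
  calc ∫⁻ x, ENNReal.ofReal z ^ copies x t i ∂(couponLaw n)
      = ∫⁻ x, ∏ k : Fin t, (if x (k : ℕ) = i then ENNReal.ofReal z else 1) ∂(couponLaw n) := by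
        simp only [pow_copies_eq_prod, Finset.prod_range]
    _ = ∏ k : Fin t, ∫⁻ x, (if x (k : ℕ) = i then ENNReal.ofReal z else 1) ∂(couponLaw n) := by
        refine ProbabilityTheory.lintegral_prod_eq_prod_lintegral_of_indepFun Finset.univ
          (fun (k : Fin t) (x : ℕ → Fin n) => if x (k : ℕ) = i then ENNReal.ofReal z else 1)
          (hind.precomp Fin.val_injective) fun k => hf.comp (measurable_pi_apply _)
    _ = ENNReal.ofReal (1 - (1 - z) / n) ^ t := by
        rw [Finset.prod_congr rfl (g := fun _ => ENNReal.ofReal (1 - (1 - z) / n))]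
        · simp
        · intro k _
          rw [← lintegral_uniform_ite n i hz, couponLaw]
          exact (measurePreserving_eval_infinitePi
            (fun _ : ℕ => (PMF.uniformOfFintype (Fin n)).toMeasure) (k : ℕ)).lintegral_comp hf

/-- Markov's inequality in the form used for the tail of `T_n(m)`: if some coupon has fewer than
`m` copies, then its contribution to the sum is at least `1`. -/
lemma indicator_lt_collectionTime_le {n : ℕ} (m t : ℕ) (x : ℕ → Fin n) {z : ℝ} (hz : 0 < z)
    (hz1 : z ≤ 1) :
    (if (t : ℕ∞) < collectionTime m x then (1 : ENNReal) else 0)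
      ≤ ∑ i : Fin n, ENNReal.ofReal (z⁻¹ ^ m) * ENNReal.ofReal z ^ copies x t i := by
  split_ifs with h
  · have : ∃ i : Fin n, copies x t i < m := by
      by_contra! hall
      exact h.not_ge (show collectionTime m x ≤ t from sInf_le ⟨t, hall, rfl⟩)
    obtain ⟨i, hi⟩ := this
    refine le_trans ?_ (Finset.single_le_sum (fun _ _ => zero_le) (Finset.mem_univ i))
    rw [← ENNReal.ofReal_pow hz.le, ← ENNReal.ofReal_mul (by positivity), ENNReal.one_le_ofReal]
    calc (1 : ℝ) = z⁻¹ ^ m * z ^ m := by rw [← mul_pow, inv_mul_cancel₀ hz.ne', one_pow]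
      _ ≤ _ := by gcongr ?_ * ?_; exact pow_le_pow_of_le_one hz.le hz1 hi.le
  · exact zero_le

lemma measurable_copies {n : ℕ} (t : ℕ) (i : Fin n) :
    Measurable fun x : ℕ → Fin n => copies x t i := by
  simp only [copies, Finset.card_filter]
  refine Finset.measurable_sum _ fun k _ => ?_
  exact (measurable_of_countable fun a : Fin n => if a = i then 1 else 0).comp
    (measurable_pi_apply k)

lemma expectedCollectionTime_le_of_cutoff (n m : ℕ) [NeZero n] (t₀ : ℕ) {z : ℝ} (hz : 0 < z)
    (hz1 : z < 1) :
    expectedCollectionTime n m ≤ ENNReal.ofReal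
      (t₀ + n * z⁻¹ ^ m * (1 - (1 - z) / n) ^ t₀ * (n / (1 - z))) := by
  have hn1 : (1 : ℝ) ≤ n := by exact_mod_cast Nat.pos_of_ne_zero (NeZero.ne n)
  have hn : (0 : ℝ) < n := by linarith
  have hy0 : 0 < 1 - z := by linarith
  have hq0 : 0 < (1 - z) / n := by positivity
  have hq1 : (1 - z) / n < 1 := by rw [div_lt_one hn]; linarith
  set r : ℝ := 1 - (1 - z) / n with hr
  have hr0 : 0 < r := by linarith
  calc expectedCollectionTime n m
      ≤ ∫⁻ x, (t₀ + ∑' s : ℕ, ∑ i : Fin n, ENNReal.ofReal (z⁻¹ ^ m) *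
          ENNReal.ofReal z ^ copies x (t₀ + s) i) ∂(couponLaw n) := by
        refine lintegral_mono fun x => (toENNReal_le_add_tsum_indicator _ t₀).trans ?_
        gcongr
        exact indicator_lt_collectionTime_le m _ x hz hz1.le
    _ = t₀ + ∑' s : ℕ, ∑ _i : Fin n, ENNReal.ofReal (z⁻¹ ^ m) * ENNReal.ofReal r ^ (t₀ + s) := by
        have hmeas (t : ℕ) (i : Fin n) :
            Measurable fun x : ℕ → Fin n => ENNReal.ofReal z ^ copies x t i :=
          (measurable_of_countable fun c : ℕ => ENNReal.ofReal z ^ c).comp (measurable_copies t i)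
        have : IsProbabilityMeasure (couponLaw n) := by unfold couponLaw; infer_instance
        rw [lintegral_add_left measurable_const, lintegral_const, measure_univ, mul_one,
          lintegral_tsum fun s => (Finset.measurable_sum _ fun i _ =>
            (hmeas (t₀ + s) i).const_mul _).aemeasurable]
        congr 2 with s
        rw [lintegral_finsetSum _ fun i _ => (hmeas (t₀ + s) i).const_mul _]
        refine Finset.sum_congr rfl fun i _ => ?_
        rw [lintegral_const_mul _ (hmeas _ _), lintegral_pow_copies n _ i hz.le]
    _ = _ := by
        have hsum : (∑' s : ℕ, ENNReal.ofReal r ^ s) = ENNReal.ofReal (n / (1 - z)) := by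
          rw [ENNReal.tsum_geometric, ← ENNReal.ofReal_one, ← ENNReal.ofReal_sub _ hr0.le,
            ← ENNReal.ofReal_inv_of_pos (by linarith)]
          rw [hr, sub_sub_cancel, inv_div]
        simp only [Finset.sum_const, Finset.card_univ, Fintype.card_fin, nsmul_eq_mul, pow_add,
          ← mul_assoc]
        rw [ENNReal.tsum_mul_left, hsum, ENNReal.ofReal_add (by positivity) (by positivity),
          ENNReal.ofReal_mul (by positivity), ENNReal.ofReal_mul (by positivity),
          ENNReal.ofReal_mul (by positivity), ENNReal.ofReal_natCast, ENNReal.ofReal_natCast,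
          ENNReal.ofReal_pow hr0.le]

/-- `E[T_n(m)] ≤ n log n / (1 - z) + C n` for every `z ∈ (0, 1)`, where `C` depends only on `z`
and `m`. -/
lemma expectedCollectionTime_le (n m : ℕ) [NeZero n] {z : ℝ} (hz : 0 < z) (hz1 : z < 1) :
    expectedCollectionTime n m ≤ ENNReal.ofReal
      (n * Real.log n / (1 - z) + n * (1 + z⁻¹ ^ m / (1 - z))) := by
  have hn1 : (1 : ℝ) ≤ n := by exact_mod_cast Nat.pos_of_ne_zero (NeZero.ne n)
  have hn : (0 : ℝ) < n := by linarith
  have hy0 : 0 < 1 - z := by linarith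
  have hlog : 0 ≤ Real.log n := Real.log_nonneg hn1
  -- At this cutoff the expected number of deficient coupons is of constant order.
  set t₀ : ℕ := ⌈n * Real.log n / (1 - z)⌉₊ with ht₀
  refine (expectedCollectionTime_le_of_cutoff n m t₀ hz hz1).trans (ENNReal.ofReal_le_ofReal ?_)
  have h1 : (t₀ : ℝ) ≤ n * Real.log n / (1 - z) + 1 := (Nat.ceil_lt_add_one (by positivity)).le
  have h2 : n * Real.log n / (1 - z) ≤ t₀ := Nat.le_ceil _
  have h3 : (1 - (1 - z) / n) ^ t₀ ≤ (n : ℝ)⁻¹ := by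
    have hb : 0 ≤ 1 - (1 - z) / n := by
      rw [sub_nonneg, div_le_one hn]; linarith
    calc (1 - (1 - z) / n) ^ t₀ ≤ Real.exp (-((1 - z) / n)) ^ t₀ := by
          gcongr; exact Real.one_sub_le_exp_neg _
      _ = Real.exp (-((1 - z) / n * t₀)) := by rw [← Real.exp_nat_mul]; congr 1; ring
      _ ≤ Real.exp (-Real.log n) := by
          gcongr
          calc Real.log n = (1 - z) / n * (n * Real.log n / (1 - z)) := by field_simp
            _ ≤ _ := by gcongr
      _ = (n : ℝ)⁻¹ := by rw [Real.exp_neg, Real.exp_log hn]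
  calc (t₀ : ℝ) + n * z⁻¹ ^ m * (1 - (1 - z) / n) ^ t₀ * (n / (1 - z))
      ≤ (n * Real.log n / (1 - z) + n) + n * z⁻¹ ^ m * (n : ℝ)⁻¹ * (n / (1 - z)) := by
        gcongr; linarith
    _ = _ := by field_simp; ring

/-! ### A lower bound for the probability of decoding failure -/

section Failure

/-- Second moment method: if `X` counts the events `A i`, then
`P(X ≥ 1) ≥ (E X)² / E X² ≥ s / (1 + s)` with `s = E X`, when the events are pairwise non-positively
correlated. -/
lemma div_one_add_le_measureReal_iUnion {Ω ι : Type*} [MeasurableSpace Ω] [Fintype ι]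
    (P : Measure Ω) [IsProbabilityMeasure P] (A : ι → Set Ω) (hA : ∀ i, MeasurableSet (A i))
    {p : ℝ} (hp : 0 ≤ p) (h1 : ∀ i, P.real (A i) = p)
    (h2 : ∀ i j, i ≠ j → P.real (A i ∩ A j) ≤ p ^ 2) :
    (Fintype.card ι : ℝ) * p / (1 + Fintype.card ι * p) ≤ P.real (⋃ i, A i) := by
  classical
  set N : ℝ := (Fintype.card ι : ℝ) with hN
  have hN0 : 0 ≤ N := Nat.cast_nonneg _
  -- The indicator of `X ≥ 1` dominates `2 a X - (a X) ^ 2` for every `a`; this `a` is `E X / E X²`.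
  set a : ℝ := (1 + N * p)⁻¹ with ha
  have ha0 : 0 ≤ a := by positivity
  have ha1 : a * (1 + N * p) = 1 := inv_mul_cancel₀ (by positivity)
  have hint (B : Set Ω) (hB : MeasurableSet B) : Integrable (B.indicator (1 : Ω → ℝ)) P :=
    (integrable_const (1 : ℝ)).indicator hB
  let X : Ω → ℝ := fun ω => ∑ i, (A i).indicator 1 ω
  have hX2 (ω : Ω) : X ω ^ 2 = ∑ i, ∑ j, (A i ∩ A j).indicator 1 ω := by
    simp only [X, sq, Finset.sum_mul_sum, Set.inter_indicator_one, Pi.mul_apply]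
  have hXint : Integrable X P := integrable_finsetSum _ fun i _ => hint _ (hA i)
  have hX2int : Integrable (fun ω => X ω ^ 2) P := by
    simp only [hX2]
    exact integrable_finsetSum _ fun i _ => integrable_finsetSum _ fun j _ =>
      hint _ ((hA i).inter (hA j))
  have hEX : ∫ ω, X ω ∂P = N * p := by
    rw [integral_finsetSum _ fun i _ => hint _ (hA i)]
    simp [integral_indicator_one (hA _), h1, hN]
  have hEX2 : ∫ ω, X ω ^ 2 ∂P ≤ N * p + (N * p) ^ 2 := by
    simp only [hX2]
    rw [integral_finsetSum _ fun i _ => integrable_finsetSum _ fun j _ =>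
      hint _ ((hA i).inter (hA j))]
    calc ∑ i, ∫ ω, ∑ j, (A i ∩ A j).indicator (1 : Ω → ℝ) ω ∂P
        = ∑ i, ∑ j, P.real (A i ∩ A j) := by
          refine Finset.sum_congr rfl fun i _ => ?_
          rw [integral_finsetSum _ fun j _ => hint _ ((hA i).inter (hA j))]
          exact Finset.sum_congr rfl fun j _ => integral_indicator_one ((hA i).inter (hA j))
      _ ≤ ∑ i : ι, ∑ j : ι, ((if i = j then p else 0) + p ^ 2) := by
          refine Finset.sum_le_sum fun i _ => Finset.sum_le_sum fun j _ => ?_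
          split_ifs with h
          · subst h; rw [Set.inter_self, h1]; nlinarith
          · rw [zero_add]; exact h2 i j h
      _ = N * p + (N * p) ^ 2 := by
          simp [Finset.sum_add_distrib, hN]; ring
  have hU : MeasurableSet (⋃ i, A i) := MeasurableSet.iUnion hA
  have hle : ∫ ω, (2 * a * X ω - a ^ 2 * X ω ^ 2) ∂P ≤ P.real (⋃ i, A i) := by
    rw [← integral_indicator_one hU]
    refine integral_mono ((hXint.const_mul _).sub (hX2int.const_mul _)) (hint _ hU) fun ω => ?_
    by_cases hω : ω ∈ ⋃ i, A i
    · rw [Set.indicator_of_mem hω]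
      show _ ≤ (1 : ℝ)
      nlinarith [sq_nonneg (1 - a * X ω)]
    · have : X ω = 0 := Finset.sum_eq_zero fun i _ =>
        Set.indicator_of_notMem (fun h => hω (Set.mem_iUnion_of_mem i h)) _
      rw [Set.indicator_of_notMem hω]
      simp [this]
  rw [integral_sub (hXint.const_mul _) (hX2int.const_mul _), integral_const_mul,
    integral_const_mul, hEX] at hle
  refine le_trans ?_ hle
  calc N * p / (1 + N * p) = 2 * a * (N * p) - a ^ 2 * (N * p + (N * p) ^ 2) := by
        rw [div_eq_mul_inv, ← ha]
        linear_combination (N * p * a) * ha1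
    _ ≤ _ := by gcongr

lemma measurableSet_codedPacket {F : Type*} {n g : ℕ} (B : Set (CodedPacket F n g)) :
    MeasurableSet B :=
  MeasurableSpace.measurableSet_top

variable {F : Type*} [Field F]

lemma Decodable.mono {n g : ℕ} {ω : ℕ → CodedPacket F n g} {s t : ℕ} (hst : s ≤ t) {j : Fin n}
    (h : Decodable ω s j) : Decodable ω t j := by
  obtain ⟨k, hk, hli⟩ := h
  exact ⟨k, fun i => ⟨(hk i).1.trans_le hst, (hk i).2⟩, hli⟩

lemma lt_decodingLatency {n g : ℕ} {ω : ℕ → CodedPacket F n g} {t : ℕ} {j : Fin n}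
    (h : ¬ Decodable ω t j) : (t : ℕ∞) < decodingLatency ω := by
  refine lt_of_lt_of_le (b := ((t + 1 : ℕ) : ℕ∞)) (by exact_mod_cast Nat.lt_succ_self t) ?_
  refine le_sInf ?_
  rintro _ ⟨s, hs, rfl⟩
  have : t < s := by
    by_contra! hst
    exact h ((hs j).mono hst)
  exact Nat.cast_le.mpr this

/-- The packets of generation `j` whose coding vector has a nonzero coordinate `i`; without
such a packet the information packet `i` of generation `j` cannot be recovered. -/
def involving {n g : ℕ} (i : Fin g) (j : Fin n) : Set (CodedPacket F n g) :=
  {p | p.generation = j ∧ p.vector i ≠ 0}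

lemma not_decodable_of_forall_notMem_involving {n g : ℕ} (i : Fin g) {ω : ℕ → CodedPacket F n g}
    {t : ℕ} {j : Fin n} (h : ∀ k < t, ω k ∉ involving i j) : ¬ Decodable ω t j := by
  rintro ⟨k, hk, hli⟩
  have hspan := hli.span_eq_top_of_card_eq_finrank' (by simp)
  have hle : Submodule.span F (Set.range fun l => (ω (k l)).vector)
      ≤ LinearMap.ker (LinearMap.proj i : (Fin g → F) →ₗ[F] F) := by
    rw [Submodule.span_le]
    rintro _ ⟨l, rfl⟩
    have := h (k l) (hk l).1
    simp only [involving, Set.mem_ofPred_eq, not_and, not_not] at this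
    exact this (hk l).2
  rw [hspan] at hle
  have : (Pi.single i 1 : Fin g → F) ∈ LinearMap.ker (LinearMap.proj i : (Fin g → F) →ₗ[F] F) :=
    hle Submodule.mem_top
  simp at this

variable [Fintype F]

lemma uniform_real_involving {n g : ℕ} [NeZero n] (i : Fin g) (j : Fin n) :
    (PMF.uniformOfFintype (CodedPacket F n g)).toMeasure.real (involving i j)
      = (1 - 1 / (Fintype.card F : ℝ)) / n := by
  classical
  have hn : (n : ℝ) ≠ 0 := by exact_mod_cast NeZero.ne n
  have hq : (Fintype.card F : ℝ) ≠ 0 := by exact_mod_cast Fintype.card_ne_zero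
  have hcard : Fintype.card (involving (F := F) i j)
      = (Fintype.card F - 1) * Fintype.card F ^ (g - 1) := by
    let e : involving (F := F) i j ≃ {v : Fin g → F // v i ≠ 0} :=
      { toFun := fun p => ⟨p.1.vector, p.2.2⟩
        invFun := fun v => ⟨(j, v.1), rfl, v.2⟩
        left_inv := fun p => Subtype.ext (Prod.ext p.2.1.symm rfl)
        right_inv := fun _ => rfl }
    have hfilter : ({v : Fin g → F | v i ≠ 0} : Finset (Fin g → F)) =
        Fintype.piFinset fun l => if l = i then ({0}ᶜ : Finset F) else Finset.univ := by
      ext v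
      simp only [Finset.mem_filter_univ, Fintype.mem_piFinset]
      refine ⟨fun h l => ?_, fun h => by simpa using h i⟩
      split_ifs with hl
      · subst hl; simpa using h
      · simp
    rw [Fintype.card_congr e, Fintype.card_subtype, hfilter, Fintype.card_piFinset]
    rw [← Finset.mul_prod_erase _ _ (Finset.mem_univ i), if_pos rfl,
      Finset.prod_congr rfl (g := fun _ => Fintype.card F)]
    · simp [Finset.card_compl]
    · intro l hl
      rw [if_neg (Finset.ne_of_mem_erase hl), Finset.card_univ]
  have htot : Fintype.card (CodedPacket F n g) = n * Fintype.card F ^ g := by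
    change Fintype.card (Fin n × (Fin g → F)) = _
    simp
  have hg : 0 < g := i.pos
  rw [measureReal_def, PMF.toMeasure_uniformOfFintype_apply _ (measurableSet_codedPacket _), hcard, htot,
    ENNReal.toReal_div, ENNReal.toReal_natCast, ENNReal.toReal_natCast]
  obtain ⟨k, rfl⟩ := Nat.exists_eq_succ_of_ne_zero hg.ne'
  push_cast [Nat.cast_sub (Fintype.card_pos (α := F) : 1 ≤ _)]
  rw [pow_succ]
  field_simp

lemma packetLaw_real_forall_mem {n g : ℕ} [NeZero n] (B : Set (CodedPacket F n g)) (t : ℕ) :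
    (packetLaw F n g).real {ω | ∀ k < t, ω k ∈ B}
      = (PMF.uniformOfFintype (CodedPacket F n g)).toMeasure.real B ^ t := by
  have : {ω : ℕ → CodedPacket F n g | ∀ k < t, ω k ∈ B}
      = Set.pi (Finset.range t : Finset ℕ) fun _ => B := by
    ext ω; simp [Set.mem_pi]
  rw [measureReal_def, measureReal_def, this, packetLaw, Measure.infinitePi_pi _ fun _ _ => measurableSet_codedPacket _]
  simp

/-- With `q` the cardinality of the field, `s` is the expected number of generations from which no
packet with a nonzero coefficient in a fixed coordinate has been collected. -/
lemma div_one_add_le_failureProb {n g : ℕ} [NeZero n] (hg : 1 ≤ g) (t : ℕ) {s : ℝ}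
    (hs : s = n * (1 - (1 - 1 / (Fintype.card F : ℝ)) / n) ^ t) :
    s / (1 + s) ≤ failureProb F n g t := by
  let i : Fin g := ⟨0, hg⟩
  let U := (PMF.uniformOfFintype (CodedPacket F n g)).toMeasure
  set p : ℝ := (1 - 1 / (Fintype.card F : ℝ)) / n with hp
  have hU (j : Fin n) : U.real (involving i j) = p := uniform_real_involving i j
  let A : Fin n → Set (ℕ → CodedPacket F n g) := fun j => {ω | ∀ k < t, ω k ∈ (involving i j)ᶜ}
  have : IsProbabilityMeasure (packetLaw F n g) := by unfold packetLaw; infer_instance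
  have hp1 : p ≤ 1 := (hU ⟨0, Nat.pos_of_ne_zero (NeZero.ne n)⟩) ▸ measureReal_le_one
  have hA (j : Fin n) : MeasurableSet (A j) := by
    have : A j = ⋂ k : ℕ, ⋂ _ : k < t, (fun ω => ω k) ⁻¹' (involving i j)ᶜ := by
      ext ω; simp [A]
    rw [this]
    exact MeasurableSet.iInter fun k => MeasurableSet.iInter fun _ => measurable_pi_apply k (measurableSet_codedPacket _)
  have h1 (j : Fin n) : (packetLaw F n g).real (A j) = (1 - p) ^ t := by
    rw [packetLaw_real_forall_mem, probReal_compl_eq_one_sub (measurableSet_codedPacket _)]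
    congr 2
    exact hU j
  have h2 (j l : Fin n) (hjl : j ≠ l) :
      (packetLaw F n g).real (A j ∩ A l) ≤ ((1 - p) ^ t) ^ 2 := by
    have hinter : A j ∩ A l = {ω | ∀ k < t, ω k ∈ (involving i j ∪ involving i l)ᶜ} := by
      ext ω
      simp only [A, Set.mem_inter_iff, Set.mem_ofPred_eq, Set.compl_union]
      exact forall₂_and.symm
    have hdisj : Disjoint (involving (F := F) i j) (involving i l) :=
      Set.disjoint_left.mpr fun _ ha hb => hjl (ha.1.symm.trans hb.1)
    have hUunion : U.real (involving i j ∪ involving i l) = p + p := by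
      rw [measureReal_union hdisj (measurableSet_codedPacket _), hU, hU]
    have hUc : U.real (involving i j ∪ involving i l)ᶜ = 1 - (p + p) := by
      rw [← hUunion]; exact probReal_compl_eq_one_sub (measurableSet_codedPacket _)
    rw [hinter, packetLaw_real_forall_mem, ← pow_mul, mul_comm t 2, pow_mul]
    refine pow_le_pow_left₀ measureReal_nonneg ?_ t
    calc _ = 1 - (p + p) := hUc
      _ ≤ (1 - p) ^ 2 := by nlinarith [sq_nonneg p]
  have key := div_one_add_le_measureReal_iUnion (packetLaw F n g) A hA
    (pow_nonneg (sub_nonneg.mpr hp1) t) h1 h2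
  rw [Fintype.card_fin, ← hs] at key
  refine key.trans (measureReal_mono (Set.iUnion_subset fun j ω hω => ?_))
  exact lt_decodingLatency (not_decodable_of_forall_notMem_involving i hω)

end Failure

/-! ### Comparison of the two bounds -/

/-- A lower bound for `log (1 - a / n)` that loses an arbitrarily small factor in front of
`a / n`. -/
lemma neg_div_le_log_one_sub_div {a b n : ℝ} (ha : 0 ≤ a) (hab : a < b) (hn : b * a / (b - a) ≤ n)
    (han : a < n) : -(b / n) ≤ Real.log (1 - a / n) := by
  have hn0 : 0 < n := ha.trans_lt han
  have hpos : 0 < 1 - a / n := by rw [sub_pos, div_lt_one hn0]; exact han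
  refine le_trans ?_ (Real.one_sub_inv_le_log_of_pos hpos)
  have h1 : b * a ≤ n * (b - a) := by rwa [div_le_iff₀ (by linarith)] at hn
  have h2 : (1 - a / n)⁻¹ = n / (n - a) := by
    rw [one_sub_div hn0.ne', inv_div]
  have h3 : 1 - n / (n - a) = -(a / (n - a)) := by
    have : n - a ≠ 0 := by linarith
    field_simp; ring
  rw [h2, h3, neg_le_neg_iff, div_le_div_iff₀ (by linarith) hn0]
  nlinarith

/-- Since `E[T_n(g)] ≤ n log n / (1 - z) + C n` with `a < 1 - z`, the expected number
`n (1 - a / n) ^ t` of waiting generations exceeds any multiple of `l` as long as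
`t < E[T_n(g)] - n log l`. -/
lemma exists_forall_mul_le_mul_pow (g : ℕ) {a : ℝ} (ha : 0 < a) (ha1 : a < 1) {K l₀ : ℝ}
    (hK : 0 < K) :
    ∃ n₀ : ℕ, ∀ (n : ℕ) [NeZero n], n₀ ≤ n → ∀ l : ℝ, 0 < l → l ≤ l₀ → ∀ t : ℕ,
      (t : ℝ) < (expectedCollectionTime n g).toReal - n * Real.log l →
        K * l ≤ n * (1 - a / n) ^ t := by
  -- Two intermediate rates `a < b < y < 1`: `b` absorbs the error in `log (1 - a / n)`, and `1 / y`
  -- is the constant of the bound for the expectation.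
  obtain ⟨y, hay, hy1⟩ := exists_between ha1
  obtain ⟨b, hab, hby⟩ := exists_between hay
  have hb : 0 < b := ha.trans hab
  have hy : 0 < y := hb.trans hby
  set C : ℝ := 1 + (1 - y)⁻¹ ^ g / y with hC
  have hlim : Filter.Tendsto (fun n : ℕ => (1 - b / y) * Real.log n) Filter.atTop Filter.atTop :=
    (Real.tendsto_log_atTop.comp tendsto_natCast_atTop_atTop).const_mul_atTop
      (sub_pos.mpr ((div_lt_one hy).mpr hby))
  obtain ⟨n₀, hn₀⟩ := Filter.eventually_atTop.mp
    (((hlim.eventually_ge_atTop (b * C + Real.log K + (1 - b) * Real.log l₀)).and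
      (tendsto_natCast_atTop_atTop.eventually_ge_atTop (b * a / (b - a)))).and
      (Filter.eventually_ge_atTop 1))
  refine ⟨n₀, fun n _ hn l hl hll t ht => ?_⟩
  obtain ⟨⟨h1, h2⟩, h3⟩ := hn₀ n hn
  have hn1 : (1 : ℝ) ≤ n := by exact_mod_cast h3
  have hn0 : (0 : ℝ) < n := by linarith
  have han : a < n := by linarith
  have hlogn : 0 ≤ Real.log n := Real.log_nonneg hn1
  have hpos : 0 < 1 - a / n := by rw [sub_pos, div_lt_one hn0]; exact han
  have hE : (expectedCollectionTime n g).toReal ≤ n * Real.log n / y + n * C := by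
    have h := expectedCollectionTime_le n g (z := 1 - y) (by linarith) (by linarith)
    rw [sub_sub_cancel] at h
    exact ENNReal.toReal_le_of_le_ofReal (by positivity) h
  have htn : b / n * t ≤ b / y * Real.log n + b * C - b * Real.log l := by
    calc b / n * t ≤ b / n * (n * Real.log n / y + n * C - n * Real.log l) := by
          gcongr; linarith
      _ = _ := by field_simp
  have hlogl : (1 - b) * Real.log l ≤ (1 - b) * Real.log l₀ := by
    have : 0 ≤ 1 - b := by linarith
    gcongr
  rw [← Real.log_le_log_iff (by positivity) (by positivity), Real.log_mul hK.ne' hl.ne',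
    Real.log_mul hn0.ne' (by positivity), Real.log_pow]
  have hlog := mul_le_mul_of_nonneg_left (neg_div_le_log_one_sub_div ha.le hab h2 han)
    (Nat.cast_nonneg (α := ℝ) t)
  linarith

/-- The common form of both bounds: `l = log (1 / (1 - δ))` gives the bound for fixed `δ₀`, and
`l = δ = (n g)⁻ᶜ` the one for polynomially small failure probabilities. -/
lemma exists_forall_sub_mul_log_le (F : Type*) [Field F] [Fintype F] {g : ℕ} (hg : 1 ≤ g)
    {δ₀ l₀ : ℝ} (hδ₀ : δ₀ < 1) :
    ∃ n₀ : ℕ, ∀ (n : ℕ) [NeZero n], n₀ ≤ n → ∀ δ l : ℝ, 0 < δ → δ ≤ δ₀ → δ ≤ l → l ≤ l₀ →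
      ∀ t : ℕ, failureProb F n g t < δ →
        (expectedCollectionTime n g).toReal - n * Real.log l ≤ t := by
  have hq : (1 : ℝ) < Fintype.card F := by exact_mod_cast Fintype.one_lt_card
  have ha : 0 < 1 - 1 / (Fintype.card F : ℝ) := by
    rw [sub_pos, div_lt_one (by linarith)]; exact hq
  have ha1 : 1 - 1 / (Fintype.card F : ℝ) < 1 := sub_lt_self _ (by positivity)
  obtain ⟨n₀, hn₀⟩ := exists_forall_mul_le_mul_pow g ha ha1
    (K := 1 / (1 - δ₀)) (one_div_pos.mpr (sub_pos.mpr hδ₀)) (l₀ := l₀)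
  refine ⟨n₀, fun n _ hn δ l hδ hδδ₀ hδl hll₀ t hfail => ?_⟩
  by_contra! ht
  have hs := hn₀ n hn l (hδ.trans_le hδl) hll₀ t ht
  have hbound := div_one_add_le_failureProb (F := F) (n := n) hg t rfl
  set s : ℝ := n * (1 - (1 - 1 / (Fintype.card F : ℝ)) / n) ^ t
  have h1 : δ ≤ s * (1 - δ₀) := by
    rw [one_div_mul_eq_div, div_le_iff₀ (sub_pos.mpr hδ₀)] at hs
    exact hδl.trans hs
  have hs0 : 0 < s := pos_of_mul_pos_left (hδ.trans_le h1) (sub_pos.mpr hδ₀).le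
  have h2 : δ ≤ s / (1 + s) := by
    rw [le_div_iff₀ (by linarith)]
    nlinarith
  linarith

end GenerationCoding

theorem corollary3 (F : Type*) [Field F] [Fintype F] (g : ℕ) (hg : 1 ≤ g) :
    (∀ (n : ℕ) [NeZero n], GenerationCoding.expectedCollectionTime n g ≠ ⊤) ∧
    (∀ δ₀ : ℝ, δ₀ < 1 → ∃ n₀ : ℕ, ∀ (n : ℕ) [NeZero n], n₀ ≤ n →
      ∀ δ : ℝ, 0 < δ → δ ≤ δ₀ → ∀ t : ℕ, GenerationCoding.failureProb F n g t < δ →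
        (GenerationCoding.expectedCollectionTime n g).toReal
          - (n : ℝ) * Real.log (Real.log (1 / (1 - δ))) ≤ (t : ℝ)) ∧
    (∀ c : ℝ, 0 < c → ∃ n₀ : ℕ, ∀ (n : ℕ) [NeZero n], n₀ ≤ n →
      ∀ t : ℕ, GenerationCoding.failureProb F n g t < 1 / ((n : ℝ) * (g : ℝ)) ^ c →
        (GenerationCoding.expectedCollectionTime n g).toReal
          + c * (n : ℝ) * Real.log ((n : ℝ) * (g : ℝ)) ≤ (t : ℝ)) := by
  refine ⟨fun n _ => ?_, fun δ₀ hδ₀ => ?_, fun c hc => ?_⟩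
  · exact ne_top_of_le_ne_top ENNReal.ofReal_ne_top
      (GenerationCoding.expectedCollectionTime_le n g (z := 1 / 2) (by norm_num) (by norm_num))
  · have hlog (δ : ℝ) : Real.log (1 / (1 - δ)) = -Real.log (1 - δ) := by
      rw [one_div, Real.log_inv]
    have hle (δ : ℝ) (hδ : δ < 1) : δ ≤ Real.log (1 / (1 - δ)) := by
      have := Real.log_le_sub_one_of_pos (sub_pos.mpr hδ)
      rw [hlog]; linarith
    obtain ⟨n₀, hn₀⟩ := GenerationCoding.exists_forall_sub_mul_log_le F hg hδ₀
      (l₀ := Real.log (1 / (1 - δ₀)))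
    refine ⟨n₀, fun n _ hn δ hδ hδδ₀ t ht =>
      hn₀ n hn δ _ hδ hδδ₀ (hle δ (hδδ₀.trans_lt hδ₀)) ?_ t ht⟩
    rw [hlog, hlog, neg_le_neg_iff]
    exact Real.log_le_log (by linarith) (by linarith)
  · obtain ⟨n₀, hn₀⟩ := GenerationCoding.exists_forall_sub_mul_log_le F hg
      (δ₀ := 1 / 2) (l₀ := 1 / 2) (by norm_num)
    obtain ⟨n₁, hn₁⟩ := Filter.eventually_atTop.mp
      (((tendsto_rpow_atTop hc).comp tendsto_natCast_atTop_atTop).eventually_ge_atTop (2 : ℝ))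
    refine ⟨max n₀ n₁, fun n _ hn t ht => ?_⟩
    have hg1 : (1 : ℝ) ≤ g := by exact_mod_cast hg
    have hn1 : (1 : ℝ) ≤ n := by exact_mod_cast Nat.pos_of_ne_zero (NeZero.ne n)
    have hng : (n : ℝ) ≤ n * g := le_mul_of_one_le_right (by linarith) hg1
    have hpow : 2 ≤ ((n : ℝ) * g) ^ c :=
      (hn₁ n ((le_max_right _ _).trans hn)).trans
        (Real.rpow_le_rpow (by linarith) hng hc.le)
    have hhalf : 1 / ((n : ℝ) * g) ^ c ≤ 1 / 2 := one_div_le_one_div_of_le (by norm_num) hpow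
    have key := hn₀ n ((le_max_left _ _).trans hn) _ _ (by positivity) hhalf le_rfl hhalf t ht
    rw [one_div, Real.log_inv, Real.log_rpow (by linarith)] at key
    linarith
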